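/- Let $N=2^m$ with $m\ge 1$, $0<\beta<\tfrac12$, $\delta=2^{-N^\beta}$, $r\ge 0$ an integer, $\eta>0$, and $\Lambda_\ell=2^{\ell}\eta\mathbb Z$ ($0\le\ell\le r$), a binary partition chain with top lattice $\Lambda=\Lambda_0$. Let $\sigma_y^2,\sigma_z^2>0$, $0\le\Delta<\sigma_z^2$, and put $$\sigma_x^2=\sigma_y^2+\sigma_z^2,\quad \Delta'=\frac{\sigma_z^2\Delta}{\sigma_z^2-\Delta},\quad \alpha_q=\frac{\sigma_x^2}{\sigma_x^2+\Delta'},\quad \alpha_c=\frac{\sigma_y^2}{\sigma_x^2+\Delta'},\quad \sigma_a^2=\alpha_q^2(\sigma_x^2+\Delta').$$ Let $A$ have the discrete Gaussian distribution on $\Lambda$ with $P(A=\lambda)\propto e^{-\lambda^2/(2\sigma_a^2)}$, let $\bar X=A+W$ and $\bar B=\bar X+V$, where $W\sim N(0,\alpha_q\Delta')$, $V\sim N(0,\tfrac{\alpha_q}{\alpha_c}\sigma_z^2)$ and $A,W,V$ are independent. Let $A_1,A_2,\dots\in\{0,1\}$ be the binary labels of $A$, i.e. $A\in\eta\big(\sum_{\ell\le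 k}2^{\ell-1}A_\ell+2^k\mathbb Z\big)$ for all $k$. Take $N$ i.i.d. copies $(A^{1:N},\bar X^{1:N},\bar B^{1:N})$, let $G_N=\left[\begin{smallmatrix}1&0\\1&1\end{smallmatrix}\right]^{\otimes m}$ over $\mathbb F_2$ with rows $\mathbf g_1,\dots,\mathbf g_N$, and let $U_\ell^{1:N}=A_\ell^{1:N}G_N$. For a binary random variable $X$ and a random variable $Y$ let $Z(X|Y)=2\,\mathbb E\sqrt{P(X=0|Y)P(X=1|Y)}$ be the Bhattacharyya parameter, and write $$Z_\ell^i=Z(U_\ell^i\,|\,U_\ell^{1:i-1},A_{1:\ell-1}^{1:N}),\quad Z_\ell^i(\bar X)=Z(U_\ell^i\,|\,U_\ell^{1:i-1},A_{1:\ell-1}^{1:N},\bar X^{1:N}),\quad Z_\ell^i(\bar B)=Z(U_\ell^i\,|\,U_\ell^{1:i-1},A_{1:\ell-1}^{1:N},\bar B^{1:N}).$$ Define, for $1\le\ell\le r$, the information and shaping sets $$\mathcal I_\ell^Q=\{i: Z_\ell^i>\delta,\ Z_\ell^i(\bar X)<1-\delta\},\qquad \mathcal S_\ell^Q=\{i: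 Z_\ell^i\le\delta\},$$ $$\mathcal I_\ell^C=\{i: Z_\ell^i\ge 1-\delta,\ Z_\ell^i(\bar B)\le\delta\},\qquad \mathcal S_\ell^C=\{i: Z_\ell^i<1-\delta\ \text{ or }\ \delta<Z_\ell^i(\bar B)<1-\delta\}.$$ For sets $K_1,\dots,K_r\subseteq\{1,\dots,N\}$ let $$L(K_1,\dots,K_r)=\Big\{\eta\Big(\sum_{\ell=1}^r2^{\ell-1}\sum_{i\in K_\ell}u_\ell^i\,\psi(\mathbf g_i)+2^r z\Big): u_\ell^i\in\{0,1\},\ z\in\mathbb Z^N\Big\},$$ where $\psi:\mathbb F_2^N\to\mathbb Z^N$ is the natural embedding (the multilevel structure of Construction D). Let $L_1=L\big((\mathcal I_\ell^Q\cup\mathcal S_\ell^Q)_\ell\big)$ be the quantization polar lattice and $L_2=L\big((\mathcal I_\ell^C\cup\mathcal S_\ell^Q)_\ell\big)$ the AWGN-coding polar lattice. Then $L_2\subseteq L_1$. This also holds if $L_2$ is built with the full shaping sets of the coding partition, i.e. $L\big((\mathcal I_\ell^C\cup\mathcal S_\ell^C)_\ell\big)\subseteq L_1$. Moreover $\mathcal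 I_\ell^C\subseteq\mathcal I_\ell^Q$ for every $1\le\ell\le r$. -/

import Mathlib

open MeasureTheory ProbabilityTheory
open scoped NNReal ENNReal

namespace PolarLattice

noncomputable section

/-- The polar transform `G_N = [[1,0],[1,1]]^{⊗ m}` over `𝔽₂`, with `N = 2 ^ m`.
The index of a Kronecker product is ordered with the first factor most significant. -/
def polarMatrix : (m : ℕ) → Matrix (Fin (2 ^ m)) (Fin (2 ^ m)) (ZMod 2)
  | 0 => 1
  | m + 1 =>
    let e : Fin 2 × Fin (2 ^ m) ≃ Fin (2 ^ (m + 1)) :=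
      finProdFinEquiv.trans (finCongr (pow_succ' 2 m).symm)
    Matrix.reindex e e (Matrix.kronecker !![1, 0; 1, 1] (polarMatrix m))

/-- The Bhattacharyya parameter
`Z(X | Y) = 2 ∑_y P_Y(y) √(P_{X|Y}(0|y) P_{X|Y}(1|y)) = 2 E[√(P(X = 0 | Y) P(X = 1 | Y))]`
of a binary random variable `X` given a random variable `Y` with values in any measurable space
(discrete or not). -/
def bhattacharyya {Ω 𝒴 : Type*} [MeasurableSpace Ω] [m𝒴 : MeasurableSpace 𝒴] (P : Measure Ω)
    (X : Ω → ZMod 2) (Y : Ω → 𝒴) : ℝ :=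
  2 * ∫ ω, √((P⟦X ⁻¹' {0} | m𝒴.comap Y⟧) ω * (P⟦X ⁻¹' {1} | m𝒴.comap Y⟧) ω) ∂P

/-- The discrete Gaussian distribution `D_{Λ,σ}` over `Λ = η ℤ` with variance parameter
`v = σ ^ 2`, written in the coordinate `k ∈ ℤ` of the lattice point `η k`:
`k` has mass `f_σ(η k) / ∑_j f_σ(η j)`. -/
def discreteGaussian (η : ℝ) (v : ℝ≥0) : Measure ℤ :=
  Measure.sum fun k : ℤ =>
    (gaussianPDF 0 v (η * k) / ∑' j : ℤ, gaussianPDF 0 v (η * j)) • Measure.dirac k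

/-- The label of the lattice point `η k` in the binary partition `η 2^ℓ ℤ / η 2^(ℓ+1) ℤ`, namely
the binary digit of weight `2 ^ ℓ` of the integer `k`, so that
`k ≡ ∑_{ℓ < r} 2^ℓ labelBit ℓ k (mod 2 ^ r)`. Levels are counted from `0`. -/
def labelBit (ℓ : ℕ) (k : ℤ) : ZMod 2 := ((k / 2 ^ ℓ : ℤ) : ZMod 2)

/-- Numerical data: block length `N = 2 ^ m`, threshold exponent `β`, the scale `η` of the top
lattice `Λ = η ℤ`, the variances of `Y` and of `Z` in the source model `X = Y + Z`, and the target
distortion `Δ`. -/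
structure Params where
  m : ℕ
  β : ℝ
  η : ℝ
  varY : ℝ
  varZ : ℝ
  Δ : ℝ

namespace Params

variable (p : Params)

/-- The threshold `2^{-N^β}`, with `N = 2 ^ m`. -/
def thr : ℝ := (2 : ℝ) ^ (-(((2 : ℝ) ^ p.m) ^ p.β))

/-- `σ_x² = σ_y² + σ_z²`. -/
def varX : ℝ := p.varY + p.varZ

/-- `Δ' = σ_z² Δ / (σ_z² - Δ)`. -/
def Δ' : ℝ := p.varZ / (p.varZ - p.Δ) * p.Δ

/-- `α_q = σ_x² / (σ_x² + Δ')`. -/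
def αq : ℝ := p.varX / (p.varX + p.Δ')

/-- `α_c = σ_y² / (σ_x² + Δ')`. -/
def αc : ℝ := p.varY / (p.varX + p.Δ')

/-- `σ_a² = α_q² σ_{x'}²`, where `σ_{x'}² = σ_x² + Δ'`. -/
def varA : ℝ := p.αq ^ 2 * (p.varX + p.Δ')

/-- The sample space for `N` copies of (lattice coordinate of `A`, quantization noise,
side-information noise). -/
abbrev Sample : Type := (Fin (2 ^ p.m) → ℤ) × (Fin (2 ^ p.m) → ℝ) × (Fin (2 ^ p.m) → ℝ)

/-- The law on the sample space: all coordinates independent, `A` discrete Gaussian with parameter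
`σ_a²`, quantization noise `N(0, α_q Δ')`, side-information noise `N(0, (α_q / α_c) σ_z²)`. -/
def law : Measure p.Sample :=
  (Measure.pi fun _ => discreteGaussian p.η p.varA.toNNReal).prod
    ((Measure.pi fun _ => gaussianReal 0 (p.αq * p.Δ').toNNReal).prod
      (Measure.pi fun _ => gaussianReal 0 (p.αq / p.αc * p.varZ).toNNReal))

/-- The vector `A^{1:N}` of i.i.d. lattice Gaussian variables. -/
def A (ω : p.Sample) : Fin (2 ^ p.m) → ℝ := fun j => p.η * ω.1 j

/-- `X̄^{1:N} = A^{1:N} + N(0, α_q Δ')`. -/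
def Xbar (ω : p.Sample) : Fin (2 ^ p.m) → ℝ := fun j => p.A ω j + ω.2.1 j

/-- `B̄^{1:N} = X̄^{1:N} + N(0, (α_q / α_c) σ_z²)`. -/
def Bbar (ω : p.Sample) : Fin (2 ^ p.m) → ℝ := fun j => p.Xbar ω j + ω.2.2 j

/-- The vector `A_ℓ^{1:N}` of labels at level `ℓ`. -/
def bits (ℓ : ℕ) (ω : p.Sample) : Fin (2 ^ p.m) → ZMod 2 := fun j => labelBit ℓ (ω.1 j)

/-- `U_ℓ^{1:N} = A_ℓ^{1:N} G_N`. -/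
def U (ℓ : ℕ) (ω : p.Sample) : Fin (2 ^ p.m) → ZMod 2 :=
  Matrix.vecMul (p.bits ℓ ω) (polarMatrix p.m)

/-- The pair `(U_ℓ^{1:i-1}, A_{1:ℓ-1}^{1:N})`: the previous `U`'s at level `ℓ` and the labels of all
previous levels. -/
def past (ℓ : ℕ) (i : Fin (2 ^ p.m)) (ω : p.Sample) :
    ({j : Fin (2 ^ p.m) // j < i} → ZMod 2) × (Fin ℓ → Fin (2 ^ p.m) → ZMod 2) :=
  (fun j => p.U ℓ ω j, fun k => p.bits k ω)

/-- `Z(U_ℓ^i | U_ℓ^{1:i-1}, A_{1:ℓ-1}^{1:N})`. -/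
def Z0 (ℓ : ℕ) (i : Fin (2 ^ p.m)) : ℝ :=
  bhattacharyya p.law (fun ω => p.U ℓ ω i) (p.past ℓ i)

/-- `Z(U_ℓ^i | U_ℓ^{1:i-1}, A_{1:ℓ-1}^{1:N}, X̄^{1:N})`. -/
def ZX (ℓ : ℕ) (i : Fin (2 ^ p.m)) : ℝ :=
  bhattacharyya p.law (fun ω => p.U ℓ ω i) (fun ω => (p.past ℓ i ω, p.Xbar ω))

/-- `Z(U_ℓ^i | U_ℓ^{1:i-1}, A_{1:ℓ-1}^{1:N}, B̄^{1:N})`. -/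
def ZB (ℓ : ℕ) (i : Fin (2 ^ p.m)) : ℝ :=
  bhattacharyya p.law (fun ω => p.U ℓ ω i) (fun ω => (p.past ℓ i ω, p.Bbar ω))

/-- The information set `I_ℓ^Q`. -/
def IQ (ℓ : ℕ) : Set (Fin (2 ^ p.m)) := {i | p.thr < p.Z0 ℓ i ∧ p.ZX ℓ i < 1 - p.thr}

/-- The shaping set `S_ℓ^Q`. -/
def SQ (ℓ : ℕ) : Set (Fin (2 ^ p.m)) := {i | p.Z0 ℓ i ≤ p.thr}

/-- The information set `I_ℓ^C`. -/
def IC (ℓ : ℕ) : Set (Fin (2 ^ p.m)) := {i | 1 - p.thr ≤ p.Z0 ℓ i ∧ p.ZB ℓ i ≤ p.thr}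

/-- The shaping set `S_ℓ^C`. -/
def SC (ℓ : ℕ) : Set (Fin (2 ^ p.m)) :=
  {i | p.Z0 ℓ i < 1 - p.thr ∨ (p.thr < p.ZB ℓ i ∧ p.ZB ℓ i < 1 - p.thr)}

/-- The multilevel (Construction D) set with `r` levels over the chain `η ℤ / η 2 ℤ / ⋯ / η 2^r ℤ`
whose code at level `ℓ` is generated by the rows `g_i`, `i ∈ K ℓ`, of `G_N`: all vectors
`η (∑_ℓ 2^ℓ ∑_{i ∈ K ℓ} u_ℓ^i ψ(g_i) + 2^r z)` with `u_ℓ^i ∈ {0, 1}` and `z ∈ ℤ^N`, where `ψ` is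
the natural embedding of `𝔽₂^N` into `ℤ^N`. -/
def multilevel (r : ℕ) (K : ℕ → Set (Fin (2 ^ p.m))) : Set (Fin (2 ^ p.m) → ℝ) :=
  {x | ∃ (u : Fin r → Fin (2 ^ p.m) → ZMod 2) (z : Fin (2 ^ p.m) → ℤ),
    (∀ (ℓ : Fin r) i, i ∉ K ℓ → u ℓ i = 0) ∧
    ∀ j, x j = p.η * (∑ ℓ : Fin r, 2 ^ (ℓ : ℕ) *
      ∑ i, ((u ℓ i).val : ℝ) * ((polarMatrix p.m i j).val : ℝ) + 2 ^ r * z j)}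

/-- The quantization polar lattice `L₁`. -/
def L₁ (r : ℕ) : Set (Fin (2 ^ p.m) → ℝ) := p.multilevel r fun ℓ => p.IQ ℓ ∪ p.SQ ℓ

/-- The channel coding polar lattice `L₂`, in which the shaping indices are those of `S_ℓ^Q`. -/
def L₂ (r : ℕ) : Set (Fin (2 ^ p.m) → ℝ) := p.multilevel r fun ℓ => p.IC ℓ ∪ p.SQ ℓ

/-- The channel coding polar lattice with its full shaping set `S_ℓ^C`, so that only the indices of
the frozen set of the channel code are frozen. -/
def L₂full (r : ℕ) : Set (Fin (2 ^ p.m) → ℝ) := p.multilevel r fun ℓ => p.IC ℓ ∪ p.SC ℓ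

end Params

end

end PolarLattice

/-!
Both lattices are built from the same matrix, so it is enough to compare index sets level by level,
and this comes down to two inequalities between Bhattacharyya parameters:
`Z(U | past, X̄) ≤ Z(U | past)` and `Z(U | past, X̄) ≤ Z(U | past, B̄)`.

The first says that conditioning on more data decreases `Z`
(`PolarLattice.bhattacharyya_le_of_comap_le`). Since `Z(X | Y) = 2 E[φ(P(X = 1 | Y))]` with the
concave function `φ x = √(x (1 - x))`, this is the conditional Jensen inequality together with
the tower property.

The second says that `B̄ = X̄ + V` is degraded with respect to `X̄`. The pair `(past, B̄)` is a
function of `(past, X̄, V)`, so `Z(U | past, X̄, V) ≤ Z(U | past, B̄)`; and `V` is independent of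
`(U, past, X̄)`, so that it carries no further information on `U` given `(past, X̄)`
(`PolarLattice.bhattacharyya_prodMk_of_indepFun`) and `Z(U | past, X̄, V) = Z(U | past, X̄)`.

As `N ^ β > 1`, the threshold `δ` is below `1 / 2`, hence `δ < 1 - δ`; the inclusions of the index
sets follow by comparing thresholds.
-/

namespace PolarLattice

/-! ### Conditional expectations and independent σ-algebras -/

/-- Enlarging the conditioning σ-algebra `m` by a σ-algebra independent of `m` and the integrand
together does not change the conditional expectation. -/
theorem condExp_sup_of_indep {Ω : Type*} {m m₁ m₂ mΩ : MeasurableSpace Ω} {P : Measure Ω}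
    [IsProbabilityMeasure P] (hm : m ≤ m₁) (hm₁ : m₁ ≤ mΩ) (hm₂ : m₂ ≤ mΩ) {f : Ω → ℝ}
    (hf : StronglyMeasurable[m₁] f) (hfi : Integrable f P) (hind : Indep m₁ m₂ P) :
    P[f | m ⊔ m₂] =ᵐ[P] P[f | m] := by
  have hmΩ : m ≤ mΩ := hm.trans hm₁
  have hsup : m ⊔ m₂ ≤ mΩ := sup_le hmΩ hm₂
  -- For `m₁`-measurable `h`, integration over `s ∩ t` factors when `s ∈ m` and `t ∈ m₂`.
  have key : ∀ h : Ω → ℝ, StronglyMeasurable[m₁] h → Integrable h P → ∀ s t, MeasurableSet[m] s →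
      MeasurableSet[m₂] t → ∫ x in s ∩ t, h x ∂P = P.real t * ∫ x in s, h x ∂P := by
    intro h hh hhi s t hs ht
    have h1 : StronglyMeasurable[m₁] (s.indicator h) := hh.indicator (hm _ hs)
    have h2 := condExp_indep_eq hm₁ hm₂ h1 hind
    have h3 : Integrable (s.indicator h) P := hhi.indicator (hmΩ _ hs)
    have h4 := setIntegral_condExp hm₂ h3 ht
    rw [setIntegral_congr_ae (g := fun _ => ∫ x, s.indicator h x ∂P) (hm₂ _ ht)
      (h2.mono fun x hx _ => hx), setIntegral_const, setIntegral_indicator (hmΩ _ hs),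
      integral_indicator (hmΩ _ hs), smul_eq_mul, Set.inter_comm] at h4
    exact h4.symm
  have hgi : Integrable (P[f | m]) P := integrable_condExp
  have hgm : StronglyMeasurable[m] (P[f | m]) := stronglyMeasurable_condExp
  let C : Set (Set Ω) := {u | ∃ s t, MeasurableSet[m] s ∧ MeasurableSet[m₂] t ∧ s ∩ t = u}
  have hC : IsPiSystem C := by
    rintro _ ⟨s, t, hs, ht, rfl⟩ _ ⟨s', t', hs', ht', rfl⟩ _
    exact ⟨s ∩ s', t ∩ t', hs.inter hs', ht.inter ht', Set.inter_inter_inter_comm _ _ _ _⟩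
  have hgen : m ⊔ m₂ = MeasurableSpace.generateFrom C := by
    apply le_antisymm
    · refine sup_le (fun s hs => ?_) (fun t ht => ?_)
      · exact MeasurableSpace.measurableSet_generateFrom
          ⟨s, Set.univ, hs, MeasurableSet.univ, Set.inter_univ s⟩
      · exact MeasurableSpace.measurableSet_generateFrom
          ⟨Set.univ, t, MeasurableSet.univ, ht, Set.univ_inter t⟩
    · refine MeasurableSpace.generateFrom_le ?_
      rintro _ ⟨s, t, hs, ht, rfl⟩
      exact MeasurableSet.inter ((le_sup_left : m ≤ m ⊔ m₂) _ hs)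
        ((le_sup_right : m₂ ≤ m ⊔ m₂) _ ht)
  refine (ae_eq_condExp_of_forall_setIntegral_eq hsup hfi (fun s _ _ => hgi.integrableOn) ?_
    (hgm.mono (le_sup_left : m ≤ m ⊔ m₂)).aestronglyMeasurable).symm
  have huniv : ∫ x, (P[f | m]) x ∂P = ∫ x, f x ∂P := integral_condExp hmΩ
  intro s hs _
  induction s, hs using MeasurableSpace.induction_on_inter hgen hC with
  | empty => simp
  | basic u hu =>
    obtain ⟨s, t, hs, ht, rfl⟩ := hu
    rw [key _ (hgm.mono hm) hgi s t hs ht, key f hf hfi s t hs ht, setIntegral_condExp hmΩ hfi hs]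
  | compl u hu ih =>
    rw [setIntegral_compl (hsup _ hu) hgi, setIntegral_compl (hsup _ hu) hfi, huniv,
      ih (measure_lt_top _ _)]
  | iUnion u hd hu ih =>
    rw [integral_iUnion (fun i => hsup _ (hu i)) hd hgi.integrableOn,
      integral_iUnion (fun i => hsup _ (hu i)) hd hfi.integrableOn]
    exact tsum_congr fun i => ih i (measure_lt_top _ _)

/-! ### Monotonicity of the Bhattacharyya parameter -/

section Bhattacharyya

variable {Ω 𝒴 𝒴' 𝒱 : Type*} [mΩ : MeasurableSpace Ω] [m𝒴 : MeasurableSpace 𝒴]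
  [m𝒴' : MeasurableSpace 𝒴'] [m𝒱 : MeasurableSpace 𝒱] {P : Measure Ω} [IsProbabilityMeasure P]
  {X : Ω → ZMod 2} {Y : Ω → 𝒴} {Y' : Ω → 𝒴'} {V : Ω → 𝒱}

theorem concaveOn_sqrt_mul_one_sub :
    ConcaveOn ℝ (Set.Icc 0 1) fun x : ℝ => √(x * (1 - x)) := by
  refine ⟨convex_Icc 0 1, fun x hx y hy a b ha hb hab => ?_⟩
  have hx' : 0 ≤ x * (1 - x) := mul_nonneg hx.1 (by linarith [hx.2])
  have hy' : 0 ≤ y * (1 - y) := mul_nonneg hy.1 (by linarith [hy.2])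
  refine (Real.strictConcaveOn_sqrt.concaveOn.2 hx' hy' ha hb hab).trans (Real.sqrt_le_sqrt ?_)
  obtain rfl : b = 1 - a := by linarith
  simp only [smul_eq_mul]
  nlinarith [mul_nonneg (mul_nonneg ha hb) (sq_nonneg (x - y))]

theorem integrable_indicator_preimage (hX : Measurable X) (c : ZMod 2) :
    Integrable ((X ⁻¹' {c}).indicator fun _ => (1 : ℝ)) P :=
  (integrable_const 1).indicator (hX (measurableSet_singleton c))

/-- The Bhattacharyya parameter as the mean of a concave function of one conditional probability. -/
theorem bhattacharyya_eq_integral (hX : Measurable X) (hY : Measurable Y) :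
    bhattacharyya P X Y =
      2 * ∫ ω, √((P⟦X ⁻¹' {1} | m𝒴.comap Y⟧) ω * (1 - (P⟦X ⁻¹' {1} | m𝒴.comap Y⟧) ω)) ∂P := by
  have hset : ((X ⁻¹' {0}).indicator fun _ => (1 : ℝ)) =
      (fun _ => (1 : ℝ)) - (X ⁻¹' {1}).indicator fun _ => (1 : ℝ) := by
    ext ω
    rcases (by decide : ∀ x : ZMod 2, x = 0 ∨ x = 1) (X ω) with h | h <;> simp [Set.indicator, h]
  have hsub := condExp_sub (integrable_const (μ := P) (1 : ℝ))
    (integrable_indicator_preimage (P := P) hX 1) (m𝒴.comap Y)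
  rw [← hset, condExp_const hY.comap_le] at hsub
  rw [bhattacharyya]
  congr 1
  refine integral_congr_ae ?_
  filter_upwards [hsub] with ω h
  rw [h, Pi.sub_apply, mul_comm]

theorem condExp_indicator_mem_Icc (hX : Measurable X) (hY : Measurable Y) :
    ∀ᵐ ω ∂P, (P⟦X ⁻¹' {1} | m𝒴.comap Y⟧) ω ∈ Set.Icc (0 : ℝ) 1 := by
  have h0 : (0 : Ω → ℝ) ≤ᵐ[P] P⟦X ⁻¹' {1} | m𝒴.comap Y⟧ :=
    condExp_nonneg (ae_of_all _ fun ω => Set.indicator_nonneg (fun _ _ => zero_le_one) ω)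
  have h1 := condExp_mono (m := m𝒴.comap Y) (integrable_indicator_preimage (P := P) hX 1)
    (integrable_const (1 : ℝ))
    (ae_of_all _ fun ω => Set.indicator_le_self' (fun _ _ => zero_le_one) ω)
  rw [condExp_const hY.comap_le] at h1
  filter_upwards [h0, h1] with ω h h' using ⟨h, h'⟩

/-- Conditioning on more data decreases the Bhattacharyya parameter. -/
theorem bhattacharyya_le_of_comap_le (hX : Measurable X) (hY : Measurable Y) (hY' : Measurable Y')
    (h : m𝒴.comap Y ≤ m𝒴'.comap Y') : bhattacharyya P X Y' ≤ bhattacharyya P X Y := by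
  rw [bhattacharyya_eq_integral hX hY, bhattacharyya_eq_integral hX hY']
  refine mul_le_mul_of_nonneg_left ?_ zero_le_two
  let φ : ℝ → ℝ := fun x => √(x * (1 - x))
  have hφc : Continuous φ := by fun_prop
  have hφi : ∀ g : Ω → ℝ, AEStronglyMeasurable g P → (∀ᵐ ω ∂P, g ω ∈ Set.Icc (0 : ℝ) 1) →
      Integrable (φ ∘ g) P := fun g hg hg01 =>
    Integrable.of_bound (hφc.comp_aestronglyMeasurable hg) 1 <| by
      filter_upwards [hg01] with ω hω
      rw [Function.comp_apply, Real.norm_of_nonneg (Real.sqrt_nonneg _)]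
      refine Real.sqrt_le_one.2 ?_
      nlinarith [hω.1, hω.2]
  have hi : Integrable (P⟦X ⁻¹' {1} | m𝒴.comap Y⟧) P := integrable_condExp
  have hi' : Integrable (P⟦X ⁻¹' {1} | m𝒴'.comap Y'⟧) P := integrable_condExp
  have hint := hφi _ hi.1 (condExp_indicator_mem_Icc hX hY)
  have hint' := hφi _ hi'.1 (condExp_indicator_mem_Icc hX hY')
  have hJ := concaveOn_sqrt_mul_one_sub.condExp_map_le hY.comap_le
    (hφc.upperSemicontinuous.upperSemicontinuousOn _) (condExp_indicator_mem_Icc hX hY') isClosed_Icc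
    hi' hint'
  have htower := condExp_condExp_of_le (μ := P)
    (f := (X ⁻¹' {1}).indicator fun _ => (1 : ℝ)) h hY'.comap_le
  calc ∫ ω, φ ((P⟦X ⁻¹' {1} | m𝒴'.comap Y'⟧) ω) ∂P
      = ∫ ω, (P[φ ∘ (P⟦X ⁻¹' {1} | m𝒴'.comap Y'⟧) | m𝒴.comap Y]) ω ∂P :=
        (integral_condExp hY.comap_le).symm
    _ ≤ ∫ ω, φ ((P⟦X ⁻¹' {1} | m𝒴.comap Y⟧) ω) ∂P := by
        refine integral_mono_ae integrable_condExp hint ?_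
        filter_upwards [hJ, htower] with ω h1 h2
        rw [Function.comp_apply, h2] at h1
        exact h1

/-- Data independent of `(X, Y)` do not change the Bhattacharyya parameter of `X` given `Y`. -/
theorem bhattacharyya_prodMk_of_indepFun (hX : Measurable X) (hY : Measurable Y)
    (hV : Measurable V) (hind : IndepFun (fun ω => (X ω, Y ω)) V P) :
    bhattacharyya P X (fun ω => (Y ω, V ω)) = bhattacharyya P X Y := by
  have hXY : Measurable fun ω => (X ω, Y ω) := hX.prodMk hY
  have hcomap : MeasurableSpace.comap (fun ω => (Y ω, V ω)) inferInstance =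
      m𝒴.comap Y ⊔ m𝒱.comap V := MeasurableSpace.comap_prodMk Y V
  have hle : m𝒴.comap Y ≤ MeasurableSpace.comap (fun ω => (X ω, Y ω)) inferInstance :=
    (MeasurableSpace.comap_prodMk X Y).symm ▸ le_sup_right
  have hcond (c : ZMod 2) : P⟦X ⁻¹' {c} | m𝒴.comap Y ⊔ m𝒱.comap V⟧ =ᵐ[P]
      P⟦X ⁻¹' {c} | m𝒴.comap Y⟧ := by
    refine condExp_sup_of_indep hle hXY.comap_le hV.comap_le ?_
      (integrable_indicator_preimage hX c) hind
    exact stronglyMeasurable_const.indicator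
      ⟨{c} ×ˢ Set.univ, (measurableSet_singleton c).prod MeasurableSet.univ, by ext; simp⟩
  rw [bhattacharyya, bhattacharyya, hcomap]
  congr 1
  refine integral_congr_ae ?_
  filter_upwards [hcond 0, hcond 1] with ω h0 h1
  rw [h0, h1]

end Bhattacharyya

/-! ### The discrete Gaussian distribution -/

theorem summable_gaussianPDFReal_int {η : ℝ} (hη : η ≠ 0) {v : ℝ≥0} (hv : v ≠ 0) :
    Summable fun j : ℤ => gaussianPDFReal 0 v (η * j) := by
  -- The terms are `exp (-π T j ^ 2)` with `T = η ^ 2 / (2 v π)`, up to a constant: a theta series.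
  have hT : 0 < η ^ 2 / (2 * v * Real.pi) := by positivity
  have h := (summable_pow_mul_jacobiTheta₂_term_bound 0 hT 0).mul_left (√(2 * Real.pi * v))⁻¹
  refine h.congr fun j => ?_
  rw [gaussianPDFReal, pow_zero, one_mul]
  congr 2
  field_simp
  ring

theorem isProbabilityMeasure_discreteGaussian {η : ℝ} (hη : η ≠ 0) {v : ℝ≥0} (hv : v ≠ 0) :
    IsProbabilityMeasure (discreteGaussian η v) := by
  refine ⟨?_⟩
  rw [discreteGaussian, Measure.sum_apply _ MeasurableSet.univ]
  simp only [Measure.smul_apply, measure_univ, smul_eq_mul, mul_one, div_eq_mul_inv]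
  rw [ENNReal.tsum_mul_right]
  refine ENNReal.mul_inv_cancel ?_ ?_
  · exact fun h => (gaussianPDF_pos 0 hv _).ne' (ENNReal.tsum_eq_zero.1 h 0)
  · simp only [gaussianPDF]
    exact (summable_gaussianPDFReal_int hη hv).tsum_ofReal_ne_top

namespace Params

variable (p : Params)

/-! ### The source model -/

theorem varA_pos (hY : 0 < p.varY) (hZ : 0 < p.varZ) (hΔ : 0 ≤ p.Δ) (hΔ' : p.Δ < p.varZ) :
    0 < p.varA := by
  have h1 : 0 ≤ p.Δ' := mul_nonneg (div_nonneg hZ.le (sub_pos.2 hΔ').le) hΔ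
  have h2 : 0 < p.varX := add_pos hY hZ
  rw [varA, αq]
  positivity

theorem isProbabilityMeasure_law (hη : 0 < p.η) (hA : 0 < p.varA) :
    IsProbabilityMeasure p.law := by
  have := isProbabilityMeasure_discreteGaussian hη.ne' (Real.toNNReal_pos.2 hA).ne'
  rw [law]
  infer_instance

theorem measurable_U (ℓ : ℕ) (i : Fin (2 ^ p.m)) : Measurable fun ω : p.Sample => p.U ℓ ω i :=
  (measurable_of_countable fun a : Fin (2 ^ p.m) → ℤ =>
    Matrix.vecMul (fun j => labelBit ℓ (a j)) (polarMatrix p.m) i).comp measurable_fst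

theorem measurable_bits (ℓ : ℕ) : Measurable (p.bits ℓ) :=
  (measurable_of_countable fun (a : Fin (2 ^ p.m) → ℤ) j => labelBit ℓ (a j)).comp measurable_fst

theorem measurable_past (ℓ : ℕ) (i : Fin (2 ^ p.m)) : Measurable (p.past ℓ i) :=
  (measurable_pi_lambda _ fun j : {j // j < i} => p.measurable_U ℓ j).prodMk
    (measurable_pi_lambda _ fun k : Fin ℓ => p.measurable_bits k)

theorem measurable_Xbar : Measurable p.Xbar := by
  refine measurable_pi_lambda _ fun j => ?_
  have h : Measurable fun ω : p.Sample => (ω.1 j : ℝ) :=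
    (measurable_of_countable fun k : ℤ => (k : ℝ)).comp
      ((measurable_pi_apply j).comp measurable_fst)
  have h' : Measurable fun ω : p.Sample => ω.2.1 j := by fun_prop
  exact (h.const_mul p.η).add h'

theorem measurable_Bbar : Measurable p.Bbar := by
  refine measurable_pi_lambda _ fun j => ?_
  have h : Measurable fun ω : p.Sample => ω.2.2 j := by fun_prop
  exact ((measurable_pi_apply j).comp p.measurable_Xbar).add h

/-- A function of the lattice variables and the quantization noise is independent of the
side-information noise. -/
theorem indepFun_sideNoise {𝒴 : Type*} [MeasurableSpace 𝒴] (hη : 0 < p.η) (hA : 0 < p.varA)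
    {F : (Fin (2 ^ p.m) → ℤ) × (Fin (2 ^ p.m) → ℝ) → 𝒴} (hF : Measurable F) :
    IndepFun (fun ω : p.Sample => F (ω.1, ω.2.1)) (fun ω => ω.2.2) p.law := by
  have := isProbabilityMeasure_discreteGaussian hη.ne' (Real.toNNReal_pos.2 hA).ne'
  have hF' : Measurable fun ω : p.Sample => F (ω.1, ω.2.1) := hF.comp (by fun_prop)
  have hV : Measurable fun ω : p.Sample => ω.2.2 := by fun_prop
  have hassoc := (MeasurableEquiv.prodAssoc (α := Fin (2 ^ p.m) → ℤ) (β := Fin (2 ^ p.m) → ℝ)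
    (γ := Fin (2 ^ p.m) → ℝ)).measurable
  rw [law, ← Measure.prodAssoc_prod, IndepFun_iff_Indep, Indep_iff]
  rintro _ _ ⟨s, hs, rfl⟩ ⟨t, ht, rfl⟩
  rw [Measure.map_apply hassoc ((hF' hs).inter (hV ht)), Measure.map_apply hassoc (hF' hs),
    Measure.map_apply hassoc (hV ht)]
  exact (indepFun_prod hF measurable_id).measure_inter_preimage_eq_mul s t hs ht

/-! ### Comparison of the index sets -/

/-- Observing `X̄^{1:N}` in addition to the past decreases the Bhattacharyya parameter. -/
theorem ZX_le_Z0 (hη : 0 < p.η) (hA : 0 < p.varA) (ℓ : ℕ) (i : Fin (2 ^ p.m)) :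
    p.ZX ℓ i ≤ p.Z0 ℓ i := by
  have := p.isProbabilityMeasure_law hη hA
  refine bhattacharyya_le_of_comap_le (p.measurable_U ℓ i) (p.measurable_past ℓ i)
    ((p.measurable_past ℓ i).prodMk p.measurable_Xbar) ?_
  exact (MeasurableSpace.comap_prodMk (p.past ℓ i) p.Xbar).symm ▸ le_sup_left

/-- `B̄^{1:N}` is a degraded version of `X̄^{1:N}`, hence leads to a larger Bhattacharyya
parameter. -/
theorem ZX_le_ZB (hη : 0 < p.η) (hA : 0 < p.varA) (ℓ : ℕ) (i : Fin (2 ^ p.m)) :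
    p.ZX ℓ i ≤ p.ZB ℓ i := by
  have := p.isProbabilityMeasure_law hη hA
  have hU := p.measurable_U ℓ i
  have hP := p.measurable_past ℓ i
  have hPX := hP.prodMk p.measurable_Xbar
  have hV : Measurable fun ω : p.Sample => ω.2.2 := by fun_prop
  have hind : IndepFun (fun ω : p.Sample => (p.U ℓ ω i, p.past ℓ i ω, p.Xbar ω))
      (fun ω => ω.2.2) p.law := by
    -- `U`, the past and `X̄` do not depend on the third component of the sample, set to `0` here.
    have hincl : Measurable fun q : (Fin (2 ^ p.m) → ℤ) × (Fin (2 ^ p.m) → ℝ) =>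
        ((q.1, q.2, 0) : p.Sample) := by fun_prop
    exact p.indepFun_sideNoise hη hA ((hU.prodMk hPX).comp hincl)
  rw [ZX, ← bhattacharyya_prodMk_of_indepFun hU hPX hV hind]
  refine bhattacharyya_le_of_comap_le hU (hP.prodMk p.measurable_Bbar) (hPX.prodMk hV) ?_
  -- `(past, B̄)` is a measurable function of `((past, X̄), V)`.
  have hg : Measurable fun q : ((({j : Fin (2 ^ p.m) // j < i} → ZMod 2) ×
      (Fin ℓ → Fin (2 ^ p.m) → ZMod 2)) × (Fin (2 ^ p.m) → ℝ)) × (Fin (2 ^ p.m) → ℝ) =>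
      (q.1.1, q.1.2 + q.2) := by fun_prop
  exact (hg.comp (comap_measurable fun ω : p.Sample => ((p.past ℓ i ω, p.Xbar ω), ω.2.2))).comap_le

theorem thr_lt_half (hβ : 0 < p.β) (hm : 1 ≤ p.m) : p.thr < 1 / 2 := by
  have hN : (1 : ℝ) < 2 ^ p.m := one_lt_pow₀ one_lt_two (by omega)
  have h1 : 1 < ((2 : ℝ) ^ p.m) ^ p.β := Real.one_lt_rpow hN hβ
  calc p.thr < (2 : ℝ) ^ (-1 : ℝ) := Real.rpow_lt_rpow_of_exponent_lt one_lt_two (by linarith)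
    _ = 1 / 2 := by rw [Real.rpow_neg_one, one_div]

theorem multilevel_mono {r : ℕ} {K K' : ℕ → Set (Fin (2 ^ p.m))} (h : ∀ ℓ, K ℓ ⊆ K' ℓ) :
    p.multilevel r K ⊆ p.multilevel r K' := by
  rintro x ⟨u, z, hu, hx⟩
  exact ⟨u, z, fun ℓ i hi => hu ℓ i fun hK => hi (h ℓ hK), hx⟩

theorem IC_subset_IQ (hthr : p.thr < 1 / 2) (hη : 0 < p.η) (hA : 0 < p.varA) (ℓ : ℕ) :
    p.IC ℓ ⊆ p.IQ ℓ := by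
  rintro i ⟨h0, hB⟩
  have := p.ZX_le_ZB hη hA ℓ i
  exact ⟨by linarith, by linarith⟩

theorem SC_subset_IQ_union_SQ (hη : 0 < p.η) (hA : 0 < p.varA) (ℓ : ℕ) :
    p.SC ℓ ⊆ p.IQ ℓ ∪ p.SQ ℓ := by
  intro i hi
  rcases le_or_gt (p.Z0 ℓ i) p.thr with h | h
  · exact Or.inr h
  · refine Or.inl ⟨h, ?_⟩
    rcases hi with h0 | ⟨_, hB⟩
    · exact (p.ZX_le_Z0 hη hA ℓ i).trans_lt h0
    · exact (p.ZX_le_ZB hη hA ℓ i).trans_lt hB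

end Params

end PolarLattice

theorem mainTheorem7 (p : PolarLattice.Params) (r : ℕ) (hm : 1 ≤ p.m)
    (hβ : 0 < p.β) (hβ' : p.β < 1 / 2) (hη : 0 < p.η)
    (hY : 0 < p.varY) (hZ : 0 < p.varZ) (hΔ : 0 ≤ p.Δ) (hΔ' : p.Δ < p.varZ) :
    p.L₂ r ⊆ p.L₁ r ∧ p.L₂full r ⊆ p.L₁ r ∧ ∀ ℓ < r, p.IC ℓ ⊆ p.IQ ℓ := by
  have hA := p.varA_pos hY hZ hΔ hΔ'
  have hIC := p.IC_subset_IQ (p.thr_lt_half hβ hm) hη hA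
  refine ⟨p.multilevel_mono fun ℓ => Set.union_subset_union_left _ (hIC ℓ),
    p.multilevel_mono fun ℓ => Set.union_subset ?_ (p.SC_subset_IQ_union_SQ hη hA ℓ),
    fun ℓ _ => hIC ℓ⟩
  exact (hIC ℓ).trans Set.subset_union_left
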